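/- Let $R=\bigoplus_{n\ge 0}R_n$ be a standard graded commutative ring, i.e. $R_0$ is a Noetherian ring and $R$ is generated as an $R_0$-algebra by finitely many elements of $R_1$; put $R_+=\bigoplus_{n>0}R_n$. Assume that $R_0$ is local with maximal ideal $\mathfrak m_0$, and let $M=\bigoplus_{n\in\mathbb Z}M_n$ be a finitely generated graded $R$-module. For ideals $I,J$ of $R$ let $\Gamma_{I,J}$ be the functor on $R$-modules given by $\Gamma_{I,J}(N)=\{x\in N : I^n x\subseteq Jx \text{ for all } n\gg 1\}$, and for $i\ge 0$ let $H^i_{I,J}$ be its $i$-th right derived functor; put $H^i_{I,J}=0$ for $i<0$. Let $c\in\mathbb Z$ be such that the $R$-module $H^i_{R_+,\mathfrak m_0R}(M)$ is Artinian for all $i>c$. Then the $R$-module $$H^c_{R_+,\mathfrak m_0R}(M)\big/\mathfrak m_0H^c_{R_+,\mathfrak m_0R}(M)$$ is Artinian. -/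

import Mathlib

open CategoryTheory Filter

universe u v

noncomputable section

namespace PairLocalCohomology

section Torsion

variable {R : Type u} [CommRing R] (I J : Ideal R)
variable {M : Type v} [AddCommGroup M] [Module R M]

/-- `x` is `(I, J)`-torsion if `I ^ n x ⊆ J x` for all sufficiently large `n`. -/
def IsPairTorsion (x : M) : Prop :=
  ∀ᶠ n : ℕ in atTop, I ^ n • Submodule.span R {x} ≤ J • Submodule.span R {x}

variable {I J}

/-- The inclusion `I x ⊆ J x` read elementwise. -/
theorem smul_span_le_iff {x : M} {K : Ideal R} :
    K • Submodule.span R {x} ≤ J • Submodule.span R {x} ↔ ∀ a ∈ K, ∃ j ∈ J, j • x = a • x := by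
  constructor
  · intro h a ha
    exact Submodule.mem_smul_span_singleton.1
      (h (Submodule.mem_smul_span_singleton.2 ⟨a, ha, rfl⟩))
  · intro h y hy
    obtain ⟨a, ha, rfl⟩ := Submodule.mem_smul_span_singleton.1 hy
    exact Submodule.mem_smul_span_singleton.2 (h a ha)

/-- One exponent is enough, since the powers of `I` decrease. -/
theorem isPairTorsion_iff {x : M} :
    IsPairTorsion I J x ↔ ∃ n : ℕ, ∀ a ∈ I ^ n, ∃ j ∈ J, j • x = a • x := by
  constructor
  · intro h
    obtain ⟨n, hn⟩ := h.exists
    exact ⟨n, smul_span_le_iff.1 hn⟩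
  · rintro ⟨n, hn⟩
    filter_upwards [eventually_ge_atTop n] with m hm
    exact smul_span_le_iff.2 fun a ha => hn a (Ideal.pow_le_pow_right hm ha)

variable (I J M)

/-- The `(I, J)`-torsion submodule `Γ_{I,J}(M) = {x ∈ M | I ^ n x ⊆ J x for n ≫ 1}`. -/
def torsion : Submodule R M where
  carrier := {x | IsPairTorsion I J x}
  zero_mem' := isPairTorsion_iff.2 ⟨0, fun a _ => ⟨0, J.zero_mem, by simp⟩⟩
  add_mem' := by
    intro x y hx hy
    obtain ⟨n, hn⟩ := isPairTorsion_iff.1 hx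
    obtain ⟨m, hm⟩ := isPairTorsion_iff.1 hy
    refine isPairTorsion_iff.2 ⟨n + m, fun c hc => ?_⟩
    rw [pow_add] at hc
    refine Submodule.mul_induction_on hc ?_ ?_
    · intro a ha b hb
      obtain ⟨j, hj, hjx⟩ := hn a ha
      obtain ⟨k, hk, hky⟩ := hm b hb
      refine ⟨j * b + (a - j) * k, J.add_mem (J.mul_mem_right _ hj) (J.mul_mem_left _ hk), ?_⟩
      have h1 : (a - j) • x = 0 := by rw [sub_smul, hjx, sub_self]
      have h2 : (b - k) • y = 0 := by rw [sub_smul, hky, sub_self]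
      have h3 : (a * b) • (x + y) - (j * b + (a - j) * k) • (x + y) =
          (b - k) • (a - j) • x + (a - j) • (b - k) • y := by
        rw [← sub_smul, smul_smul, smul_smul, smul_add]
        congr 2 <;> ring
      rw [h1, h2, smul_zero, smul_zero, add_zero, sub_eq_zero] at h3
      exact h3.symm
    · rintro a b ⟨j, hj, hja⟩ ⟨k, hk, hkb⟩
      exact ⟨j + k, J.add_mem hj hk, by rw [add_smul, add_smul, hja, hkb]⟩
  smul_mem' := by
    intro r x hx
    obtain ⟨n, hn⟩ := isPairTorsion_iff.1 hx
    refine isPairTorsion_iff.2 ⟨n, fun a ha => ?_⟩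
    obtain ⟨j, hj, hjx⟩ := hn a ha
    exact ⟨j, hj, by rw [smul_comm j r, smul_comm a r, hjx]⟩

variable {M}

theorem map_mem_torsion {N : Type v} [AddCommGroup N] [Module R N] (f : M →ₗ[R] N) {x : M}
    (hx : x ∈ torsion I J M) : f x ∈ torsion I J N := by
  obtain ⟨n, hn⟩ := isPairTorsion_iff.1 hx
  refine isPairTorsion_iff.2 ⟨n, fun a ha => ?_⟩
  obtain ⟨j, hj, hjx⟩ := hn a ha
  exact ⟨j, hj, by rw [← map_smul, ← map_smul, hjx]⟩

end Torsion

section Cohomology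

variable {R : Type u} [CommRing R] (I J : Ideal R)

/-- The `(I, J)`-torsion functor `Γ_{I,J}` on `R`-modules; on maps it is restriction. -/
def torsionFunctor : ModuleCat.{u} R ⥤ ModuleCat.{u} R where
  obj M := ModuleCat.of R (torsion I J M)
  map f := ModuleCat.ofHom
    (f.hom.restrict (p := torsion I J _) (q := torsion I J _) fun _ hx => map_mem_torsion I J f.hom hx)

instance : (torsionFunctor I J).Additive where

/-- `H^i_{I,J}(M)`: the `i`-th right derived functor of `Γ_{I,J}` evaluated at `M`,
with the convention that it is zero for `i < 0`. -/
def localCohomology (M : Type u) [AddCommGroup M] [Module R M] : ℤ → ModuleCat.{u} R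
  | Int.ofNat i => ((torsionFunctor I J).rightDerived i).obj (ModuleCat.of R M)
  | Int.negSucc _ => ModuleCat.of R PUnit

end Cohomology

section Graded

variable {R : Type u} [CommRing R] (𝒜 : ℕ → AddSubgroup R) [GradedRing 𝒜]

/-- A graded ring `R = ⨁_{n ≥ 0} R_n` is standard graded (and then Noetherian) if `R_0` is
Noetherian and `R` is generated as an `R_0`-algebra by finitely many elements of `R_1`. -/
structure IsStandardGraded : Prop where
  isNoetherianRing_zero : IsNoetherianRing (𝒜 0)
  exists_generators : ∃ s : Finset R, (s : Set R) ⊆ 𝒜 1 ∧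
    Algebra.adjoin (𝒜 0) (s : Set R) = ⊤

/-- The subgroups `ℳ n`, `n ∈ ℤ`, make `M` a graded module over the graded ring `R`. -/
structure IsGradedModule {M : Type v} [AddCommGroup M] [Module R M] (ℳ : ℤ → AddSubgroup M) :
    Prop where
  isInternal : DirectSum.IsInternal ℳ
  smul_mem : ∀ (n : ℕ) (k : ℤ), ∀ a ∈ 𝒜 n, ∀ x ∈ ℳ k, a • x ∈ ℳ (n + k)

/-- The irrelevant ideal `R_+ = ⨁_{n > 0} R_n`. -/
abbrev irrelevantIdeal : Ideal R := (HomogeneousIdeal.irrelevant 𝒜).toIdeal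

/-- The extension `m₀R` to `R` of the maximal ideal `m₀` of the local ring `R_0`. -/
def baseMaximalIdeal [IsLocalRing (𝒜 0)] : Ideal R :=
  (IsLocalRing.maximalIdeal (𝒜 0)).map (algebraMap (𝒜 0) R)

/-- `H^i_{R_+, m₀R}(M)`. -/
abbrev gradedLocalCohomology [IsLocalRing (𝒜 0)] (M : Type u) [AddCommGroup M] [Module R M]
    (i : ℤ) : ModuleCat.{u} R :=
  localCohomology (irrelevantIdeal 𝒜) (baseMaximalIdeal 𝒜) M i

end Graded

end PairLocalCohomology

end

/-! The grading matters only through two facts: `R` is Noetherian, and `R_+ + m₀R` is a maximal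
ideal. The result then holds for any ideals `I`, `J` of a Noetherian ring with `I ⊔ J` maximal and
any finitely generated module `A` (`isArtinian_derivedTorsion_quotient`).

The argument is Noetherian induction over the quotients of `M`. Write `H^i` for `H^i_{I,J}` and `B =
A / Γ_J(A)`. All `H^i(Γ_J(A))` are Artinian (`isArtinian_derivedTorsion_of_pow_smul`), so `A` may be
exchanged for `B`. If `B ≠ 0`, some `r ∈ J` is regular on `B`, and `B / rB` is a smaller quotient of
`M` with Artinian `H^i` for `i > c`; by induction `H^c(B/rB) / J H^c(B/rB)` is Artinian. The map
`H^c(B) → H^c(B/rB)` has Artinian cokernel, inside `H^{c+1}(B)`, and its kernel `r H^c(B)` vanishes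
modulo `J`. By `isArtinian_quotient_smul_top` this suffices to descend to `H^c(B)`, and the same
lemma leads back to `H^c(A)`.

The long exact sequence of derived functors comes from a horseshoe construction. -/

noncomputable section

namespace PairLocalCohomology

/-! ### Horseshoe lemma and the long exact sequence of right derived functors. -/

section Horseshoe

open Limits HomologicalComplex

section TwistedSum

variable {V : Type*} [Category* V] [Preadditive V] [HasBinaryBiproducts V]

/-- The differential of a direct sum twisted by a map `τ`. -/
def twistedMap {A B A' B' : V} (d : A ⟶ A') (e : B ⟶ B') (τ : B ⟶ A') : A ⊞ B ⟶ A' ⊞ B' :=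
  biprod.map d e + biprod.snd ≫ τ ≫ biprod.inl

theorem inl_twistedMap {A B A' B' : V} (d : A ⟶ A') (e : B ⟶ B') (τ : B ⟶ A') :
    biprod.inl ≫ twistedMap d e τ = d ≫ biprod.inl := by
  simp [twistedMap]

theorem twistedMap_snd {A B A' B' : V} (d : A ⟶ A') (e : B ⟶ B') (τ : B ⟶ A') :
    twistedMap d e τ ≫ biprod.snd = biprod.snd ≫ e := by
  simp [twistedMap]

theorem twistedMap_fst {A B A' B' : V} (d : A ⟶ A') (e : B ⟶ B') (τ : B ⟶ A') :
    twistedMap d e τ ≫ biprod.fst = biprod.fst ≫ d + biprod.snd ≫ τ := by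
  simp [twistedMap]

theorem twistedMap_snd_assoc {A B A' B' Z : V} (d : A ⟶ A') (e : B ⟶ B') (τ : B ⟶ A')
    (h : B' ⟶ Z) : twistedMap d e τ ≫ biprod.snd ≫ h = biprod.snd ≫ e ≫ h := by
  simp [twistedMap]

theorem twistedMap_fst_assoc {A B A' B' Z : V} (d : A ⟶ A') (e : B ⟶ B') (τ : B ⟶ A')
    (h : A' ⟶ Z) :
    twistedMap d e τ ≫ biprod.fst ≫ h = (biprod.fst ≫ d + biprod.snd ≫ τ) ≫ h := by
  rw [← Category.assoc, twistedMap_fst]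

theorem twistedMap_comp {A B A' B' A'' B'' : V} (d : A ⟶ A') (e : B ⟶ B') (τ : B ⟶ A')
    (d' : A' ⟶ A'') (e' : B' ⟶ B'') (τ' : B' ⟶ A'') (hd : d ≫ d' = 0) (he : e ≫ e' = 0)
    (h : τ ≫ d' + e ≫ τ' = 0) : twistedMap d e τ ≫ twistedMap d' e' τ' = 0 := by
  apply biprod.hom_ext
  · rw [Category.assoc, twistedMap_fst, Preadditive.comp_add, twistedMap_fst_assoc,
      twistedMap_snd_assoc, Preadditive.add_comp, Category.assoc, Category.assoc, hd, comp_zero,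
      zero_add, ← Preadditive.comp_add, h, comp_zero, zero_comp]
  · rw [Category.assoc, twistedMap_snd, twistedMap_snd_assoc, he, comp_zero, zero_comp]

variable {ι : Type*} {c : ComplexShape ι} (K L : HomologicalComplex V c)
  (τ : ∀ i j, L.X i ⟶ K.X j)

/-- The direct sum of two complexes with differential twisted by a family of maps `L i ⟶ K j`
that anticommutes with the differentials. -/
def twistedSum (h0 : ∀ i j, ¬ c.Rel i j → τ i j = 0)
    (hτ : ∀ i j k, c.Rel i j → c.Rel j k → τ i j ≫ K.d j k + L.d i j ≫ τ j k = 0) :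
    HomologicalComplex V c where
  X n := K.X n ⊞ L.X n
  d i j := twistedMap (K.d i j) (L.d i j) (τ i j)
  shape i j hij := by
    rw [K.shape i j hij, L.shape i j hij, h0 i j hij]
    apply biprod.hom_ext <;> simp [twistedMap]
  d_comp_d' i j k hij hjk :=
    twistedMap_comp _ _ _ _ _ _ (K.d_comp_d i j k) (L.d_comp_d i j k) (hτ i j k hij hjk)

variable {K L τ} (h0 : ∀ i j, ¬ c.Rel i j → τ i j = 0)
    (hτ : ∀ i j k, c.Rel i j → c.Rel j k → τ i j ≫ K.d j k + L.d i j ≫ τ j k = 0)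

/-- The inclusion of the subcomplex in a twisted sum. -/
def twistedSumInl : K ⟶ twistedSum K L τ h0 hτ where
  f _ := biprod.inl
  comm' i j _ := inl_twistedMap (K.d i j) (L.d i j) (τ i j)

/-- The projection of a twisted sum to the quotient complex. -/
def twistedSumSnd : twistedSum K L τ h0 hτ ⟶ L where
  f _ := biprod.snd
  comm' i j _ := (twistedMap_snd (K.d i j) (L.d i j) (τ i j)).symm

theorem twistedSumInl_snd : twistedSumInl h0 hτ ≫ twistedSumSnd h0 hτ = 0 :=
  HomologicalComplex.hom_ext _ _ fun _ => biprod.inl_snd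

/-- A twisted sum is degreewise split. -/
def twistedSumSplitting (n : ι) :
    ((ShortComplex.mk _ _ (twistedSumInl_snd h0 hτ)).map (eval V c n)).Splitting where
  r := biprod.fst
  s := biprod.inr
  f_r := biprod.inl_fst
  s_g := biprod.inr_snd
  id := biprod.total

end TwistedSum

variable {C : Type*} [Category* C] [Abelian C]

/-- The augmentation of an injective resolution in degree zero. -/
def augmentation {Z : C} (I : InjectiveResolution Z) : Z ⟶ I.cocomplex.X 0 := I.ι.f 0

instance {Z : C} (I : InjectiveResolution Z) : Mono (augmentation I) :=
  inferInstanceAs (Mono (I.ι.f 0))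

@[simp]
theorem augmentation_d {Z : C} (I : InjectiveResolution Z) :
    augmentation I ≫ I.cocomplex.d 0 1 = 0 :=
  I.ι_f_zero_comp_complex_d

theorem augmentation_exact {Z : C} (I : InjectiveResolution Z) :
    (ShortComplex.mk _ _ (augmentation_d I)).Exact :=
  I.exact₀

/-- The complex `K` with its term of degree `0` removed, and the sign of its differential
changed. -/
def shiftedComplex (K : CochainComplex C ℕ) : CochainComplex C ℕ where
  X n := K.X (n + 1)
  d i j := -K.d (i + 1) (j + 1)
  shape i j hij := by
    rw [K.shape, neg_zero]
    simpa using hij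

/-- These are the data of the middle resolution: `t` twists the differential of `I₁ ⊕ I₃`, and `b`
is the first component of the augmentation of `S.X₂`. Extend the augmentation of `I₁` to `b`; then
`-(b ≫ d)` kills `S.X₁`, so it factors through `S.X₃` and extends to `t 0`. The other `t n` form the
lift of `t 0` to a chain map into the shifted complex. -/
theorem exists_twist {S : ShortComplex C} (hS : S.ShortExact) (I₁ : InjectiveResolution S.X₁)
    (I₃ : InjectiveResolution S.X₃) :
    ∃ (b : S.X₂ ⟶ I₁.cocomplex.X 0) (t : ∀ n, I₃.cocomplex.X n ⟶ I₁.cocomplex.X (n + 1)),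
      (∀ n, t n ≫ I₁.cocomplex.d (n + 1) (n + 2) + I₃.cocomplex.d n (n + 1) ≫ t (n + 1) = 0) ∧
      S.f ≫ b = augmentation I₁ ∧
      b ≫ I₁.cocomplex.d 0 1 + (S.g ≫ augmentation I₃) ≫ t 0 = 0 := by
  have := hS.mono_f
  have := hS.epi_g
  let b : S.X₂ ⟶ I₁.cocomplex.X 0 := Injective.factorThru (augmentation I₁) S.f
  have hb : S.f ≫ b = augmentation I₁ := Injective.comp_factorThru _ _
  have hbd : S.f ≫ (-(b ≫ I₁.cocomplex.d 0 1)) = 0 := by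
    rw [Preadditive.comp_neg, ← Category.assoc, hb, augmentation_d, neg_zero]
  let e : S.X₃ ⟶ I₁.cocomplex.X 1 := hS.exact.desc _ hbd
  have he : S.g ≫ e = -(b ≫ I₁.cocomplex.d 0 1) := hS.exact.g_desc _ hbd
  let t0 : I₃.cocomplex.X 0 ⟶ I₁.cocomplex.X 1 := Injective.factorThru e (augmentation I₃)
  have ht0 : augmentation I₃ ≫ t0 = e := Injective.comp_factorThru _ _
  have hed : e ≫ I₁.cocomplex.d 1 2 = 0 := by
    rw [← cancel_epi S.g, ← Category.assoc, he]
    simp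
  have h1 : augmentation I₃ ≫ t0 ≫ (-I₁.cocomplex.d 1 2) = 0 := by
    rw [← Category.assoc, ht0, Preadditive.comp_neg, hed, neg_zero]
  let t1 : I₃.cocomplex.X 1 ⟶ I₁.cocomplex.X 2 :=
    (augmentation_exact I₃).descToInjective _ h1
  have ht1 : t0 ≫ (-I₁.cocomplex.d 1 2) = I₃.cocomplex.d 0 1 ≫ t1 :=
    ((augmentation_exact I₃).comp_descToInjective _ h1).symm
  have key (n : ℕ) (f : I₃.cocomplex.X n ⟶ I₁.cocomplex.X (n + 1))
      (f' : I₃.cocomplex.X (n + 1) ⟶ I₁.cocomplex.X (n + 1 + 1))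
      (h : f ≫ (-I₁.cocomplex.d (n + 1) (n + 1 + 1)) = I₃.cocomplex.d n (n + 1) ≫ f') :
      ∃ f'' : I₃.cocomplex.X (n + 2) ⟶ I₁.cocomplex.X (n + 2 + 1),
        f' ≫ (-I₁.cocomplex.d (n + 1 + 1) (n + 2 + 1)) =
          I₃.cocomplex.d (n + 1) (n + 2) ≫ f'' := by
    have h2 : I₃.cocomplex.d n (n + 1) ≫ f' ≫ (-I₁.cocomplex.d (n + 1 + 1) (n + 2 + 1)) = 0 := by
      rw [← Category.assoc, ← h]
      simp
    exact ⟨(I₃.exact_succ n).descToInjective _ h2,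
      ((I₃.exact_succ n).comp_descToInjective _ h2).symm⟩
  obtain ⟨t, ht, h0⟩ : ∃ t : ∀ n, I₃.cocomplex.X n ⟶ I₁.cocomplex.X (n + 1),
      (∀ n, t n ≫ (-I₁.cocomplex.d (n + 1) (n + 2)) = I₃.cocomplex.d n (n + 1) ≫ t (n + 1)) ∧
        t 0 = t0 := by
    let t : I₃.cocomplex ⟶ shiftedComplex I₁.cocomplex :=
      CochainComplex.mkHom _ (shiftedComplex I₁.cocomplex) t0 t1 ht1
        (fun n p => ⟨(key n p.1 p.2.1 p.2.2).choose, (key n p.1 p.2.1 p.2.2).choose_spec⟩)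
    exact ⟨fun n => t.f n, fun n => t.comm n (n + 1), rfl⟩
  refine ⟨b, t, fun n => ?_, hb, ?_⟩
  · rw [← ht n, Preadditive.comp_neg, add_neg_cancel]
  · rw [Category.assoc, h0, ht0, he, add_neg_cancel]

theorem augmentation_comp_eq {Z : C} {K : CochainComplex C ℕ}
    (f g : (CochainComplex.single₀ C).obj Z ⟶ K) (h : (f.f 0 : Z ⟶ K.X 0) = g.f 0) : f = g :=
  (CochainComplex.fromSingle₀Equiv K Z).injective (Subtype.ext h)

/-- A map from an object to a complex which is part of a map of short exact sequences with
injective resolutions on both ends is an injective resolution. -/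
theorem quasiIso_of_shortExact {S : ShortComplex C} (hS : S.ShortExact)
    (I₁ : InjectiveResolution S.X₁) (I₃ : InjectiveResolution S.X₃) (T : CochainComplex C ℕ)
    (i : I₁.cocomplex ⟶ T) (p : T ⟶ I₃.cocomplex) (w : i ≫ p = 0)
    (hT : (ShortComplex.mk i p w).ShortExact) (j : (CochainComplex.single₀ C).obj S.X₂ ⟶ T)
    (h₁ : I₁.ι ≫ i = (CochainComplex.single₀ C).map S.f ≫ j)
    (h₃ : j ≫ p = (CochainComplex.single₀ C).map S.g ≫ I₃.ι) : QuasiIso j where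
  quasiIsoAt n := by
    rcases n with _ | n
    · have := hS.mono_f
      have := hS.epi_g
      have := hT.mono_f
      let φ : S.map (CochainComplex.single₀ C) ⟶ ShortComplex.mk i p w :=
        { τ₁ := I₁.ι
          τ₂ := j
          τ₃ := I₃.ι
          comm₁₂ := h₁
          comm₂₃ := h₃ }
      let H := homologyFunctor C (ComplexShape.up ℕ) 0
      let ψ := H.mapShortComplex.map φ
      have hR : ((S.map (CochainComplex.single₀ C)).map H).ShortExact :=
        ShortComplex.shortExact_of_iso
          (S.mapNatIso (homologyFunctorSingleIso C (ComplexShape.up ℕ) 0)).symm hS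
      have e₁ : IsIso ψ.τ₁ := inferInstanceAs (IsIso (homologyMap I₁.ι 0))
      have e₃ : IsIso ψ.τ₃ := inferInstanceAs (IsIso (homologyMap I₃.ι 0))
      -- Nothing precedes degree zero, so `H^0` is the object of cycles and preserves monomorphisms.
      have hi : Mono (homologyMap i 0) := by
        have h := CochainComplex.isoHomologyπ₀_inv_naturality i
        have : Mono (homologyMap i 0 ≫ (CochainComplex.isoHomologyπ₀ T).inv) := by
          have : Mono (i.f 0) := inferInstanceAs (Mono ((eval C _ 0).map i))
          rw [h]
          infer_instance
        exact mono_of_mono (homologyMap i 0) (CochainComplex.isoHomologyπ₀ T).inv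
      -- Surjectivity on `H^0` is inherited from `S.g`, through the isomorphism induced by `I₃.ι`.
      have hp : Epi (homologyMap p 0) := by
        have h : Epi (ψ.τ₂ ≫ homologyMap p 0) := by
          have : ψ.τ₂ ≫ homologyMap p 0 = _ := ψ.comm₂₃
          rw [this]
          exact @epi_comp _ _ _ _ _ _ hR.epi_g _ (IsIso.epi_of_iso (homologyMap I₃.ι 0))
        exact epi_of_epi ψ.τ₂ _
      have hR' : ((ShortComplex.mk i p w).map H).ShortExact :=
        { exact := hT.homology_exact₂ 0
          mono_f := hi
          epi_g := hp }
      rw [quasiIsoAt_iff_isIso_homologyMap]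
      exact ShortComplex.isIso₂_of_shortExact_of_isIso₁₃ ψ hR hR'
    · rw [quasiIsoAt_iff_exactAt _ _ (CochainComplex.exactAt_succ_single_obj _ _)]
      exact hT.exactAt_X₂ (n + 1) (I₁.cocomplex_exactAt_succ n) (I₃.cocomplex_exactAt_succ n)

theorem exists_injectiveResolution_splitting {S : ShortComplex C} (hS : S.ShortExact)
    (I₁ : InjectiveResolution S.X₁) (I₃ : InjectiveResolution S.X₃) :
    ∃ (I₂ : InjectiveResolution S.X₂) (i : I₁.cocomplex ⟶ I₂.cocomplex)
      (p : I₂.cocomplex ⟶ I₃.cocomplex) (w : i ≫ p = 0),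
      (∀ n, Nonempty ((ShortComplex.mk i p w).map (eval C _ n)).Splitting) ∧
      augmentation I₁ ≫ i.f 0 = S.f ≫ augmentation I₂ ∧
      augmentation I₂ ≫ p.f 0 = S.g ≫ augmentation I₃ := by
  obtain ⟨b, t, ht, hb, hbt⟩ := exists_twist hS I₁ I₃
  -- The family `t` is spread over all pairs of degrees, with value zero off the differentials as
  -- `twistedSum` demands.
  let τ (i j : ℕ) : I₃.cocomplex.X i ⟶ I₁.cocomplex.X j :=
    if h : i + 1 = j then t i ≫ (I₁.cocomplex.XIsoOfEq h).hom else 0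
  have h0 (i j : ℕ) (h : ¬ (ComplexShape.up ℕ).Rel i j) : τ i j = 0 := dif_neg h
  have hτ1 (i : ℕ) : τ i (i + 1) = t i :=
    (dif_pos rfl).trans (Category.comp_id (t i))
  have hτ (i j k : ℕ) (hij : (ComplexShape.up ℕ).Rel i j) (hjk : (ComplexShape.up ℕ).Rel j k) :
      τ i j ≫ I₁.cocomplex.d j k + I₃.cocomplex.d i j ≫ τ j k = 0 := by
    obtain rfl : i + 1 = j := hij
    obtain rfl : i + 1 + 1 = k := hjk
    rw [hτ1, hτ1]
    exact ht i
  let T := twistedSum I₁.cocomplex I₃.cocomplex τ h0 hτ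
  let β : S.X₂ ⟶ T.X 0 := biprod.lift b (S.g ≫ augmentation I₃)
  have hβ : β ≫ T.d 0 1 = 0 := by
    change biprod.lift b (S.g ≫ augmentation I₃) ≫
      twistedMap (I₁.cocomplex.d 0 1) (I₃.cocomplex.d 0 1) (τ 0 1) = 0
    rw [hτ1 0]
    apply biprod.hom_ext
    · rw [Category.assoc, twistedMap_fst, Preadditive.comp_add, biprod.lift_fst_assoc,
        biprod.lift_snd_assoc, hbt, zero_comp]
    · rw [Category.assoc, twistedMap_snd, biprod.lift_snd_assoc, Category.assoc, augmentation_d,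
        comp_zero, zero_comp]
  let ιT : (CochainComplex.single₀ C).obj S.X₂ ⟶ T :=
    (CochainComplex.fromSingle₀Equiv T S.X₂).symm ⟨β, hβ⟩
  have hιT : ιT.f 0 = β :=
    congrArg Subtype.val ((CochainComplex.fromSingle₀Equiv T S.X₂).apply_symm_apply ⟨β, hβ⟩)
  have hc₁ : augmentation I₁ ≫ biprod.inl =
      S.f ≫ biprod.lift b (S.g ≫ augmentation I₃) := by
    refine biprod.hom_ext _ _ ?_ ?_
    · rw [Category.assoc, biprod.inl_fst, Category.comp_id, Category.assoc, biprod.lift_fst, hb]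
    · rw [Category.assoc, biprod.inl_snd, comp_zero, Category.assoc, biprod.lift_snd,
        ← Category.assoc, S.zero, zero_comp]
  have hc₃ : β ≫ biprod.snd = S.g ≫ augmentation I₃ := biprod.lift_snd _ _
  have hq : QuasiIso ιT := by
    refine quasiIso_of_shortExact hS I₁ I₃ T (twistedSumInl h0 hτ)
      (twistedSumSnd h0 hτ) (twistedSumInl_snd h0 hτ)
      (shortExact_of_degreewise_shortExact _ fun n => (twistedSumSplitting h0 hτ n).shortExact) ιT
      (augmentation_comp_eq _ _ ?_) (augmentation_comp_eq _ _ ?_)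
    · exact hc₁.trans (congrArg₂ (fun (x : S.X₁ ⟶ S.X₂) (y : S.X₂ ⟶ T.X 0) => x ≫ y)
        (CochainComplex.single₀_map_f_zero S.f).symm hιT.symm)
    · exact (congrArg (fun x : S.X₂ ⟶ T.X 0 => x ≫ biprod.snd) hιT).trans (hc₃.trans
        (congrArg (fun x : S.X₂ ⟶ S.X₃ => x ≫ augmentation I₃)
          (CochainComplex.single₀_map_f_zero S.g).symm))
  refine ⟨⟨T, fun n => ?_, ιT, hq⟩, twistedSumInl h0 hτ, twistedSumSnd h0 hτ, twistedSumInl_snd h0 hτ,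
    fun n => ⟨twistedSumSplitting h0 hτ n⟩, ?_, ?_⟩
  · exact inferInstanceAs (Injective (I₁.cocomplex.X n ⊞ I₃.cocomplex.X n))
  · exact hc₁.trans (congrArg (S.f ≫ ·) hιT.symm)
  · exact (congrArg (fun x : S.X₂ ⟶ T.X 0 => x ≫ biprod.snd) hιT).trans hc₃

/-- Transport of a connecting morphism along isomorphisms. -/
theorem exists_exact_of_iso {A₁ A₂ A₃ A₁' A₂' B₁ B₂ B₃ B₁' B₂' : C} (e₁ : A₁ ≅ B₁) (e₂ : A₂ ≅ B₂)
    (e₃ : A₃ ≅ B₃) (e₁' : A₁' ≅ B₁') (e₂' : A₂' ≅ B₂') (f : A₁ ⟶ A₂) (g : A₂ ⟶ A₃)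
    (f' : A₁' ⟶ A₂') (k : B₁ ⟶ B₂) (l : B₂ ⟶ B₃) (d : B₃ ⟶ B₁') (k' : B₁' ⟶ B₂')
    (hf : f ≫ e₂.hom = e₁.hom ≫ k) (hg : g ≫ e₃.hom = e₂.hom ≫ l)
    (hf' : f' ≫ e₂'.hom = e₁'.hom ≫ k') (w₂ : k ≫ l = 0) (w₃ : l ≫ d = 0) (w₁ : d ≫ k' = 0)
    (h₂ : (ShortComplex.mk k l w₂).Exact) (h₃ : (ShortComplex.mk l d w₃).Exact)
    (h₁ : (ShortComplex.mk d k' w₁).Exact) :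
    ∃ δ : A₃ ⟶ A₁', (∃ w, (ShortComplex.mk f g w).Exact) ∧ (∃ w, (ShortComplex.mk g δ w).Exact) ∧
      ∃ w, (ShortComplex.mk δ f' w).Exact := by
  let δ : A₃ ⟶ A₁' := e₃.hom ≫ d ≫ e₁'.inv
  have hδ : δ ≫ e₁'.hom = e₃.hom ≫ d := by simp [δ]
  have v₂ : f ≫ g = 0 := by
    rw [← cancel_mono e₃.hom, Category.assoc, hg, ← Category.assoc, hf, Category.assoc, w₂,
      comp_zero, zero_comp]
  have v₃ : g ≫ δ = 0 := by
    rw [← cancel_mono e₁'.hom, Category.assoc, hδ, ← Category.assoc, hg, Category.assoc, w₃,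
      comp_zero, zero_comp]
  have v₁ : δ ≫ f' = 0 := by
    rw [← cancel_mono e₂'.hom, Category.assoc, hf', ← Category.assoc, hδ, Category.assoc, w₁,
      comp_zero, zero_comp]
  exact ⟨δ, ⟨v₂, (ShortComplex.exact_iff_of_iso (ShortComplex.isoMk e₁ e₂ e₃ hf.symm hg.symm)).2 h₂⟩,
    ⟨v₃, (ShortComplex.exact_iff_of_iso (ShortComplex.isoMk e₂ e₃ e₁' hg.symm hδ.symm)).2 h₃⟩,
    ⟨v₁, (ShortComplex.exact_iff_of_iso (ShortComplex.isoMk e₃ e₁' e₂' hδ.symm hf'.symm)).2 h₁⟩⟩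

/-- The long exact sequence of right derived functors. -/
theorem exists_rightDerived_exact [HasInjectiveResolutions C] {D : Type*} [Category* D] [Abelian D]
    (F : C ⥤ D) [F.Additive] {S : ShortComplex C} (hS : S.ShortExact) (n : ℕ) :
    ∃ δ : (F.rightDerived n).obj S.X₃ ⟶ (F.rightDerived (n + 1)).obj S.X₁,
      (∃ w, (ShortComplex.mk ((F.rightDerived n).map S.f) ((F.rightDerived n).map S.g) w).Exact) ∧
      (∃ w, (ShortComplex.mk ((F.rightDerived n).map S.g) δ w).Exact) ∧
      ∃ w, (ShortComplex.mk δ ((F.rightDerived (n + 1)).map S.f) w).Exact := by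
  let I₁ := injectiveResolution S.X₁
  let I₃ := injectiveResolution S.X₃
  obtain ⟨I₂, i, p, w, hs, h₁, h₃⟩ := exists_injectiveResolution_splitting hS I₁ I₃
  let G := F.mapHomologicalComplex (ComplexShape.up ℕ)
  -- An additive functor keeps degreewise splittings, so no exactness of `F` is needed.
  have hG : ((ShortComplex.mk i p w).map G).ShortExact :=
    shortExact_of_degreewise_shortExact _ fun n => ((hs n).some.map F).shortExact
  exact exists_exact_of_iso (I₁.isoRightDerivedObj F n) (I₂.isoRightDerivedObj F n)
    (I₃.isoRightDerivedObj F n) (I₁.isoRightDerivedObj F (n + 1))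
    (I₂.isoRightDerivedObj F (n + 1)) _ _ _ _ _ (hG.δ n (n + 1) rfl) _
    (InjectiveResolution.isoRightDerivedObj_hom_naturality S.f I₁ I₂ i h₁ F n)
    (InjectiveResolution.isoRightDerivedObj_hom_naturality S.g I₂ I₃ p h₃ F n)
    (InjectiveResolution.isoRightDerivedObj_hom_naturality S.f I₁ I₂ i h₁ F (n + 1))
    _ _ _ (hG.homology_exact₂ n) (hG.homology_exact₃ n (n + 1) rfl)
    (hG.homology_exact₁ n (n + 1) rfl)

end Horseshoe

/-! ### Linearity, torsion and degree zero of the derived functors. -/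

section Functoriality

variable {R : Type u} [CommRing R] (I J : Ideal R)

/-- `H^n_{I,J}(M)` for a natural number `n`. -/
abbrev derivedTorsion (n : ℕ) (M : Type u) [AddCommGroup M] [Module R M] : ModuleCat.{u} R :=
  ((torsionFunctor I J).rightDerived n).obj (ModuleCat.of R M)

variable {A B C : Type u} [AddCommGroup A] [Module R A] [AddCommGroup B] [Module R B]
  [AddCommGroup C] [Module R C]

/-- The map induced by a linear map on `H^n_{I,J}`. -/
def derivedTorsionMap (n : ℕ) (f : A →ₗ[R] B) :
    derivedTorsion I J n A →ₗ[R] derivedTorsion I J n B :=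
  (((torsionFunctor I J).rightDerived n).map (ModuleCat.ofHom f)).hom

/-- The long exact sequence of `H^n_{I,J}`. -/
theorem exists_derivedTorsion_exact (n : ℕ) {f : A →ₗ[R] B} {g : B →ₗ[R] C}
    (hf : Function.Injective f) (hg : Function.Surjective g) (hfg : Function.Exact f g) :
    ∃ δ : derivedTorsion I J n C →ₗ[R] derivedTorsion I J (n + 1) A,
      Function.Exact (derivedTorsionMap I J n f) (derivedTorsionMap I J n g) ∧
      Function.Exact (derivedTorsionMap I J n g) δ ∧
      Function.Exact δ (derivedTorsionMap I J (n + 1) f) := by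
  let S : ShortComplex (ModuleCat.{u} R) :=
    ShortComplex.mk (ModuleCat.ofHom f) (ModuleCat.ofHom g)
      (ModuleCat.hom_ext (LinearMap.ext fun x => hfg.apply_apply_eq_zero x))
  have hS : S.ShortExact :=
    { exact := (ShortComplex.ShortExact.moduleCat_exact_iff_function_exact S).2 hfg
      mono_f := (ModuleCat.mono_iff_injective _).2 hf
      epi_g := (ModuleCat.epi_iff_surjective _).2 hg }
  obtain ⟨δ, ⟨_, h₁⟩, ⟨_, h₂⟩, ⟨_, h₃⟩⟩ := exists_rightDerived_exact (torsionFunctor I J) hS n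
  exact ⟨δ.hom, (ShortComplex.ShortExact.moduleCat_exact_iff_function_exact _).1 h₁,
    (ShortComplex.ShortExact.moduleCat_exact_iff_function_exact _).1 h₂,
    (ShortComplex.ShortExact.moduleCat_exact_iff_function_exact _).1 h₃⟩

theorem torsionFunctor_map_smul {X Y : ModuleCat.{u} R} (r : R) (f : X ⟶ Y) :
    (torsionFunctor I J).map (r • f) = r • (torsionFunctor I J).map f := rfl

theorem homologyMap_eq_smul_id (K : CochainComplex (ModuleCat.{u} R) ℕ) (r : R) (φ : K ⟶ K)
    (hφ : ∀ i, φ.f i = r • 𝟙 (K.X i)) (n : ℕ) :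
    HomologicalComplex.homologyMap φ n = r • 𝟙 (K.homology n) := by
  have h : (HomologicalComplex.shortComplexFunctor (ModuleCat.{u} R) (ComplexShape.up ℕ) n).map φ =
      r • 𝟙 (K.sc n) := by
    ext1 <;> exact hφ _
  change ShortComplex.homologyMap ((HomologicalComplex.shortComplexFunctor (ModuleCat.{u} R)
    (ComplexShape.up ℕ) n).map φ) = _
  rw [h, ShortComplex.homologyMap_smul, ShortComplex.homologyMap_id]
  rfl

/-- Multiplication by `r` on an injective resolution lifts multiplication by `r` on `A`, and the
torsion functor is `R`-linear. -/
theorem derivedTorsionMap_lsmul (n : ℕ) (r : R) (x : derivedTorsion I J n A) :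
    derivedTorsionMap I J n (LinearMap.lsmul R A r) x = r • x := by
  let P := injectiveResolution (ModuleCat.of R A)
  let φ : P.cocomplex ⟶ P.cocomplex :=
    { f := fun i => r • 𝟙 (P.cocomplex.X i)
      comm' := fun i j _ => by simp }
  have hw : P.ι.f 0 ≫ φ.f 0 = ModuleCat.ofHom (LinearMap.lsmul R A r) ≫ P.ι.f 0 := by
    change augmentation P ≫ (r • 𝟙 (P.cocomplex.X 0)) = _ ≫ augmentation P
    ext x
    simp
  have h := InjectiveResolution.isoRightDerivedObj_hom_naturality
    (ModuleCat.ofHom (LinearMap.lsmul R A r)) P P φ hw (torsionFunctor I J) n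
  have h2 := homologyMap_eq_smul_id
    (((torsionFunctor I J).mapHomologicalComplex _).obj P.cocomplex) r
    (((torsionFunctor I J).mapHomologicalComplex _).map φ)
    (fun i => by
      change (torsionFunctor I J).map (r • 𝟙 (P.cocomplex.X i)) = _
      exact (torsionFunctor_map_smul I J r (𝟙 (P.cocomplex.X i))).trans
        (congrArg (r • ·) ((torsionFunctor I J).map_id _))) n
  have h3 : ((torsionFunctor I J).rightDerived n).map (ModuleCat.ofHom (LinearMap.lsmul R A r)) =
      r • 𝟙 _ := by
    rw [← cancel_mono (P.isoRightDerivedObj (torsionFunctor I J) n).hom, h]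
    refine (congrArg ((P.isoRightDerivedObj (torsionFunctor I J) n).hom ≫ ·) h2).trans ?_
    exact (Linear.comp_smul _ _ _ _ _ _).trans ((congrArg (r • ·) (Category.comp_id _)).trans
      ((congrArg (r • ·) (Category.id_comp _)).symm.trans (Linear.smul_comp _ _ _ _ _ _).symm))
  exact congrArg (fun f => f.hom x) h3

theorem derivedTorsion_smul_eq_zero {r : R} (h : ∀ a : A, r • a = 0) (n : ℕ)
    (x : derivedTorsion I J n A) : r • x = 0 := by
  rw [← derivedTorsionMap_lsmul]
  have : LinearMap.lsmul R A r = LinearMap.lsmul R A 0 := LinearMap.ext fun a => by simp [h a]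
  rw [this, derivedTorsionMap_lsmul, zero_smul]

theorem isPairTorsion_of_injective {f : A →ₗ[R] B} (hf : Function.Injective f) {x : A}
    (hx : f x ∈ torsion I J B) : x ∈ torsion I J A := by
  obtain ⟨n, hn⟩ := isPairTorsion_iff.1 hx
  refine isPairTorsion_iff.2 ⟨n, fun a ha => ?_⟩
  obtain ⟨j, hj, h⟩ := hn a ha
  exact ⟨j, hj, hf (by rw [map_smul, map_smul, h])⟩

theorem mem_torsion_torsion (x : torsion I J A) : x ∈ torsion I J (torsion I J A) :=
  isPairTorsion_of_injective I J (f := (torsion I J A).subtype) Subtype.val_injective x.2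

/-- Cohomology is a subquotient of the torsion submodule of an injective module, and being torsion
passes to submodules and quotients. -/
theorem derivedTorsion_mem_torsion (n : ℕ) (x : derivedTorsion I J n A) :
    x ∈ torsion I J (derivedTorsion I J n A) := by
  let P := injectiveResolution (ModuleCat.of R A)
  let K := ((torsionFunctor I J).mapHomologicalComplex _).obj P.cocomplex
  let e : derivedTorsion I J n A ≅ K.homology n := P.isoRightDerivedObj (torsionFunctor I J) n
  have hinj : Function.Injective e.hom.hom := (ModuleCat.mono_iff_injective _).1 inferInstance
  refine isPairTorsion_of_injective I J hinj ?_
  obtain ⟨z, hz⟩ := (ModuleCat.epi_iff_surjective (K.homologyπ n)).1 inferInstance (e.hom.hom x)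
  rw [← hz]
  refine map_mem_torsion I J (K.homologyπ n).hom ?_
  exact isPairTorsion_of_injective I J (f := (K.iCycles n).hom)
    ((ModuleCat.mono_iff_injective _).1 inferInstance)
    (mem_torsion_torsion I J (A := P.cocomplex.X n) _)

/-- Left exactness holds because torsion of an element can be tested after an injective map. It
identifies the zeroth derived functor with the torsion functor. -/
instance : Limits.PreservesFiniteLimits (torsionFunctor I J) := by
  rw [Functor.preservesFiniteLimits_iff_forall_exact_map_and_mono]
  intro S hS
  have hinj := hS.moduleCat_injective_f
  have hex := (ShortComplex.ShortExact.moduleCat_exact_iff_function_exact S).1 hS.exact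
  constructor
  · rw [ShortComplex.ShortExact.moduleCat_exact_iff_function_exact]
    intro y
    constructor
    · intro hy
      obtain ⟨x, hx⟩ := (hex y.1).1 (congrArg Subtype.val hy)
      exact ⟨⟨x, isPairTorsion_of_injective I J (f := S.f.hom) hinj (hx ▸ y.2)⟩, Subtype.ext hx⟩
    · rintro ⟨x, rfl⟩
      exact Subtype.ext ((hex _).2 ⟨x.1, rfl⟩)
  · rw [ModuleCat.mono_iff_injective]
    exact fun x y h => Subtype.ext (hinj (congrArg Subtype.val h))

/-- `H^0_{I,J}(A) = Γ_{I,J}(A)`. -/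
def derivedTorsionZeroEquiv : derivedTorsion I J 0 A ≃ₗ[R] torsion I J A :=
  ((torsionFunctor I J).rightDerivedZeroIsoSelf.app (ModuleCat.of R A)).toLinearEquiv

theorem derivedTorsionZeroEquiv_naturality (f : A →ₗ[R] B) (x : derivedTorsion I J 0 A) :
    (derivedTorsionZeroEquiv I J (derivedTorsionMap I J 0 f x) : B) =
      f (derivedTorsionZeroEquiv I J x) := by
  have h := (torsionFunctor I J).rightDerivedZeroIsoSelf.hom.naturality (ModuleCat.ofHom f)
  exact congrArg (fun g => (g.hom x).1) h

end Functoriality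

/-! ### Ordinary `I`-torsion modules are acyclic. -/

section Vanishing

variable {R : Type u} [CommRing R] (I J : Ideal R)
variable {A B : Type u} [AddCommGroup A] [Module R A] [AddCommGroup B] [Module R B]

/-- For `J = ⊥` the pair torsion is the usual `Γ_I`, so `torsion I ⊥` serves as `Γ_I` throughout. -/
theorem mem_torsion_bot {x : A} : x ∈ torsion I ⊥ A ↔ ∃ n : ℕ, ∀ a ∈ I ^ n, a • x = 0 := by
  refine isPairTorsion_iff.trans (exists_congr fun n => forall₂_congr fun a _ => ?_)
  constructor
  · rintro ⟨j, hj, h⟩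
    rw [← h, (Submodule.mem_bot R).1 hj, zero_smul]
  · exact fun h => ⟨0, Submodule.zero_mem _, by rw [zero_smul, h]⟩

theorem mem_torsion_of_mem_torsion_bot {x : A} (hx : x ∈ torsion I ⊥ A) : x ∈ torsion I J A := by
  obtain ⟨n, hn⟩ := (mem_torsion_bot I).1 hx
  exact isPairTorsion_iff.2 ⟨n, fun a ha => ⟨0, J.zero_mem, by rw [zero_smul, hn a ha]⟩⟩

theorem derivedTorsion_subsingleton_of_injective (E : Type u) [AddCommGroup E] [Module R E]
    [Module.Injective R E] (n : ℕ) : Subsingleton (derivedTorsion I J (n + 1) E) :=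
  have : CategoryTheory.Injective (ModuleCat.of R E) :=
    Module.injective_object_of_injective_module R E
  ModuleCat.subsingleton_of_isZero
    ((torsionFunctor I J).isZero_rightDerived_obj_injective_succ n (ModuleCat.of R E))

/-- A finitely generated submodule of an `I`-torsion module is killed by a power of `I`. -/
theorem exists_pow_smul_eq_zero {N : Submodule R A} (hN : N.FG) (h : N ≤ torsion I ⊥ A) :
    ∃ n : ℕ, ∀ a ∈ I ^ n, ∀ x ∈ N, a • x = 0 := by
  induction N, hN using Submodule.fg_induction with
  | singleton x =>
    obtain ⟨n, hn⟩ := (mem_torsion_bot I).1 (h (Submodule.mem_span_singleton_self x))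
    refine ⟨n, fun a ha y hy => ?_⟩
    obtain ⟨r, rfl⟩ := Submodule.mem_span_singleton.1 hy
    rw [smul_comm, hn a ha, smul_zero]
  | sup N₁ hN₁ N₂ hN₂ h₁ h₂ =>
    obtain ⟨n, hn⟩ := h₁ (le_sup_left.trans h)
    obtain ⟨m, hm⟩ := h₂ (le_sup_right.trans h)
    refine ⟨n + m, fun a ha x hx => ?_⟩
    obtain ⟨y, hy, z, hz, rfl⟩ := Submodule.mem_sup.1 hx
    rw [smul_add, hn a (Ideal.pow_le_pow_right (Nat.le_add_right _ _) ha) y hy,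
      hm a (Ideal.pow_le_pow_right (Nat.le_add_left _ _) ha) z hz, add_zero]

/-- Over a Noetherian ring, the `I`-torsion submodule of an injective module is injective. -/
instance injective_torsion_bot [IsNoetherianRing R] (E : Type u) [AddCommGroup E] [Module R E]
    [hE : Module.Injective R E] : Module.Injective R (torsion I ⊥ E) := by
  refine Module.Baer.injective fun K g => ?_
  obtain ⟨n, hn⟩ := exists_pow_smul_eq_zero I (A := E)
    (N := ((torsion I ⊥ E).subtype.comp g).range)
    (by rw [LinearMap.range_eq_map]; exact (IsNoetherian.noetherian (⊤ : Submodule R K)).map _)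
    (by rintro _ ⟨x, rfl⟩; exact (g x).2)
  -- Artin–Rees: `I ^ (n + k) ∩ K` lies in `I ^ n K`, and `I ^ n` kills the range of `g`.
  obtain ⟨k, hk⟩ := Ideal.exists_pow_inf_eq_pow_smul I (K : Submodule R R)
  have hk' := hk (n + k) (Nat.le_add_left _ _)
  -- `g` vanishes on `I ^ (n + k) ∩ K`
  have hg : ∀ x (hx : x ∈ K), x ∈ I ^ (n + k) → g ⟨x, hx⟩ = 0 := by
    intro x hx hxm
    have hle : I ^ (n + k - k) • (I ^ k • (⊤ : Submodule R R) ⊓ K) ≤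
        ((LinearMap.ker g).map K.subtype : Submodule R R) := by
      rw [Nat.add_sub_cancel, Submodule.smul_le]
      intro a ha y hy
      refine ⟨⟨a • y, K.smul_mem a hy.2⟩, ?_, rfl⟩
      have h0 : a • g ⟨y, hy.2⟩ = 0 := Subtype.ext (hn a ha (g ⟨y, hy.2⟩ : E) ⟨⟨y, hy.2⟩, rfl⟩)
      exact (map_smul g a ⟨y, hy.2⟩).trans h0
    have hxi : x ∈ I ^ (n + k) • (⊤ : Submodule R R) ⊓ K :=
      ⟨by simpa using hxm, hx⟩
    rw [hk'] at hxi
    obtain ⟨y, hy, hyx⟩ := hle hxi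
    have : y = ⟨x, hx⟩ := Subtype.ext hyx
    rw [← this]
    exact hy
  -- Now `g` factors through the image of `K` in `R ⧸ m`. Extending from there, rather than from
  -- `K`, gives a map to `E` whose values are killed by `m`, hence torsion.
  let m : Ideal R := I ^ (n + k)
  let π : K →ₗ[R] R ⧸ m := m.mkQ.comp K.subtype
  let g₁ : K ⧸ LinearMap.ker π →ₗ[R] E :=
    (LinearMap.ker π).liftQ ((torsion I ⊥ E).subtype.comp g) (by
      intro x hx
      have : (x : R) ∈ m := (Submodule.Quotient.mk_eq_zero m).1 hx
      simp [hg x x.2 this])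
  let i₁ : K ⧸ LinearMap.ker π →ₗ[R] R ⧸ m := (LinearMap.ker π).liftQ π le_rfl
  obtain ⟨h, hh⟩ := hE.out i₁ (LinearMap.ker_eq_bot.1 (Submodule.ker_liftQ_eq_bot _ _ _ le_rfl)) g₁
  have hmem : ∀ y, h y ∈ torsion I ⊥ E := fun y => (mem_torsion_bot I).2 ⟨n + k, fun a ha => by
    obtain ⟨r, rfl⟩ := m.mkQ_surjective y
    rw [← map_smul, ← map_smul]
    have : m.mkQ (a • r) = 0 := (Submodule.Quotient.mk_eq_zero m).2 (m.mul_mem_right r ha)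
    rw [this, map_zero]⟩
  refine ⟨(h.codRestrict _ hmem).comp m.mkQ, fun x hx => Subtype.ext ?_⟩
  exact hh ((LinearMap.ker π).mkQ ⟨x, hx⟩)

/-- An `I`-torsion module embeds in an injective `I`-torsion module. -/
theorem exists_injective_torsion [IsNoetherianRing R] (A : Type u) [AddCommGroup A]
    [Module R A] (hA : ∀ x : A, x ∈ torsion I ⊥ A) :
    ∃ (E : Type u) (_ : AddCommGroup E) (_ : Module R E) (f : A →ₗ[R] E),
      Module.Injective R E ∧ (∀ x : E, x ∈ torsion I ⊥ E) ∧ Function.Injective f := by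
  let E := Injective.under (ModuleCat.of R A)
  let f : A →ₗ[R] E := (Injective.ι (ModuleCat.of R A)).hom
  have hf : Function.Injective f :=
    (ModuleCat.mono_iff_injective (Injective.ι (ModuleCat.of R A))).1 inferInstance
  have hE : Module.Injective R E :=
    Module.injective_module_of_injective_object R E
      (inj := (inferInstance : CategoryTheory.Injective E))
  exact ⟨torsion I ⊥ E, inferInstance, inferInstance,
    f.codRestrict _ fun x => map_mem_torsion I ⊥ f (hA x), inferInstance,
    mem_torsion_torsion I ⊥, fun x y h => hf (congrArg Subtype.val h)⟩

/-- `I`-torsion modules have no higher `(I, J)`-local cohomology. -/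
theorem derivedTorsion_subsingleton [IsNoetherianRing R] (n : ℕ) (A : Type u) [AddCommGroup A]
    [Module R A] (hA : ∀ x : A, x ∈ torsion I ⊥ A) :
    Subsingleton (derivedTorsion I J (n + 1) A) := by
  induction n generalizing A with
  | zero =>
    obtain ⟨E, _, _, f, hE, htE, hf⟩ := exists_injective_torsion I A hA
    obtain ⟨δ, -, h₂, h₃⟩ := exists_derivedTorsion_exact I J 0 hf (LinearMap.range f).mkQ_surjective
      (LinearMap.exact_map_mkQ_range f)
    have := derivedTorsion_subsingleton_of_injective I J E 0
    -- `E` is its own `(I, J)`-torsion submodule, so in degree zero the map is the quotient map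
    -- itself.
    have hsurj : Function.Surjective (derivedTorsionMap I J 0 (LinearMap.range f).mkQ) := by
      intro y
      obtain ⟨b, hb⟩ := (LinearMap.range f).mkQ_surjective (derivedTorsionZeroEquiv I J y)
      refine ⟨(derivedTorsionZeroEquiv I J).symm ⟨b, mem_torsion_of_mem_torsion_bot I J (htE b)⟩, ?_⟩
      apply (derivedTorsionZeroEquiv I J).injective
      apply Subtype.ext
      rw [derivedTorsionZeroEquiv_naturality, LinearEquiv.apply_symm_apply]
      exact hb
    refine subsingleton_of_forall_eq 0 fun x => ?_
    obtain ⟨y, rfl⟩ := (h₃ x).1 (Subsingleton.elim _ _)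
    exact (h₂ y).2 (hsurj y)
  | succ n ih =>
    obtain ⟨E, _, _, f, hE, htE, hf⟩ := exists_injective_torsion I A hA
    obtain ⟨δ, -, h₂, h₃⟩ := exists_derivedTorsion_exact I J (n + 1) hf
      (LinearMap.range f).mkQ_surjective (LinearMap.exact_map_mkQ_range f)
    have := derivedTorsion_subsingleton_of_injective I J E (n + 1)
    have := ih (E ⧸ LinearMap.range f) fun y => by
      obtain ⟨b, rfl⟩ := (LinearMap.range f).mkQ_surjective y
      exact map_mem_torsion I ⊥ _ (htE b)
    refine subsingleton_of_forall_eq 0 fun x => ?_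
    obtain ⟨y, rfl⟩ := (h₃ x).1 (Subsingleton.elim _ _)
    rw [Subsingleton.elim y 0, map_zero]

end Vanishing

/-! ### Criteria for Artinian modules. -/

section Artinian

variable {R : Type*} [CommRing R] {A B C : Type*} [AddCommGroup A] [Module R A]
  [AddCommGroup B] [Module R B] [AddCommGroup C] [Module R C]

/-- If every element of `A` is killed by a power of `r`, and the kernel of `r` on `A` is Artinian,
then `A` is Artinian. -/
theorem isArtinian_of_ker_lsmul (r : R) (hA : ∀ x : A, ∃ n : ℕ, r ^ n • x = 0)
    [hK : IsArtinian R (LinearMap.ker (LinearMap.lsmul R A r))] : IsArtinian R A := by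
  rw [← monotone_stabilizes_iff_artinian] at hK ⊢
  intro L
  have hL : ∀ {i j : ℕ}, i ≤ j → OrderDual.ofDual (L j) ≤ OrderDual.ofDual (L i) :=
    fun h => L.monotone h
  -- `S j k` is `r ^ k L_j ∩ ker r`, decreasing in both indices. Stability of the diagonal from `n`
  -- on handles every `k ≥ n`; the finitely many rows `k < n` stabilise separately, so one `m` works
  -- for all `k`.
  let S (j k : ℕ) : Submodule R (LinearMap.ker (LinearMap.lsmul R A r)) :=
    ((OrderDual.ofDual (L j)).map (LinearMap.lsmul R A (r ^ k))).comap (Submodule.subtype _)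
  have hS {j j' k k' : ℕ} (hj : j ≤ j') (hk : k ≤ k') : S j' k' ≤ S j k := by
    rintro y ⟨z, hz, hzy⟩
    refine ⟨r ^ (k' - k) • z, Submodule.smul_mem _ _ (hL hj hz), ?_⟩
    rw [← hzy, LinearMap.lsmul_apply, LinearMap.lsmul_apply, smul_smul, ← pow_add,
      Nat.add_sub_cancel' hk]
  obtain ⟨n, hn⟩ := hK ⟨fun j => OrderDual.toDual (S j j), fun _ _ h => hS h h⟩
  choose N hN using fun k => hK ⟨fun j => OrderDual.toDual (S j k), fun _ _ h => hS h le_rfl⟩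
  let m := max n ((Finset.range n).sup N)
  have hm (j k : ℕ) (hj : m ≤ j) : S m k ≤ S j k := by
    rcases lt_or_ge k n with hk | hk
    · have h : N k ≤ m :=
        (Finset.le_sup (f := N) (Finset.mem_range.2 hk)).trans (le_max_right _ _)
      have h₁ : S (N k) k = S m k := hN k m h
      have h₂ : S (N k) k = S j k := hN k j (h.trans hj)
      rw [← h₁, h₂]
    · have h₁ : S n n = S (max j k) (max j k) :=
        hn (max j k) (hk.trans (le_max_right _ _))
      calc S m k ≤ S n n := hS (le_max_left _ _) hk
        _ = S (max j k) (max j k) := h₁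
        _ ≤ S j k := hS (le_max_left _ _) (le_max_right _ _)
  refine ⟨m, fun j hj => le_antisymm (L.monotone hj) ?_⟩
  -- In the step, `r ^ k • y` lies in `S m k ≤ S j k`, so subtracting an element of `L j` leaves
  -- something killed by `r ^ k`.
  have key (k : ℕ) : ∀ y ∈ OrderDual.ofDual (L m), r ^ k • y = 0 → y ∈ OrderDual.ofDual (L j) := by
    induction k with
    | zero =>
      intro y _ hy
      rw [pow_zero, one_smul] at hy
      rw [hy]
      exact Submodule.zero_mem _
    | succ k ih =>
      intro y hy hky
      have hyK : r ^ k • y ∈ LinearMap.ker (LinearMap.lsmul R A r) := by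
        rw [LinearMap.mem_ker, LinearMap.lsmul_apply, smul_smul, ← pow_succ', hky]
      have : (⟨r ^ k • y, hyK⟩ : LinearMap.ker (LinearMap.lsmul R A r)) ∈ S m k := ⟨y, hy, rfl⟩
      obtain ⟨z, hz, hzy⟩ := hm j k hj this
      have hzy' : r ^ k • z = r ^ k • y := hzy
      have := ih (y - z) (Submodule.sub_mem _ hy (hL hj hz)) (by rw [smul_sub, hzy', sub_self])
      simpa using Submodule.add_mem _ this hz
  intro y hy
  obtain ⟨k, hk⟩ := hA y
  exact key k y hy hk

theorem isArtinian_of_exact [IsArtinian R A] [IsArtinian R C] {f : A →ₗ[R] B} {g : B →ₗ[R] C}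
    (h : Function.Exact f g) : IsArtinian R B :=
  isArtinian_of_range_eq_ker f g (LinearMap.exact_iff.1 h).symm

/-- Each layer `N / mN` of the `m`-adic filtration is a finite-dimensional vector space over `R /
m`. -/
theorem isArtinian_of_pow_smul_eq_zero [IsNoetherianRing R] [Module.Finite R A] {m : Ideal R}
    [m.IsMaximal] {n : ℕ} (h : ∀ a ∈ m ^ n, ∀ x : A, a • x = 0) : IsArtinian R A := by
  have H : ∀ (n : ℕ) (N : Submodule R A), (∀ a ∈ m ^ n, ∀ x ∈ N, a • x = 0) → IsArtinian R N := by
    intro n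
    induction n with
    | zero =>
      intro N hN
      have : Subsingleton N := subsingleton_of_forall_eq 0 fun x =>
        Subtype.ext (by simpa using hN 1 (by simp) x x.2)
      infer_instance
    | succ n ih =>
      intro N hN
      have h₁ : IsArtinian R (m • N : Submodule R A) := by
        refine ih _ fun a ha x hx => ?_
        induction hx using Submodule.smul_induction_on' with
        | smul r hr y hy => rw [smul_smul]; exact hN _ (Ideal.mul_mem_mul ha hr) y hy
        | add y _ z _ hy hz => rw [smul_add, hy, hz, add_zero]
      have h₂ : IsArtinian R (N ⧸ (m • ⊤ : Submodule R N)) := by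
        let _ := Ideal.Quotient.field m
        have : Module.Finite (R ⧸ m) (N ⧸ (m • ⊤ : Submodule R N)) :=
          Module.Finite.of_restrictScalars_finite R _ _
        have : IsArtinian (R ⧸ m) (N ⧸ (m • ⊤ : Submodule R N)) := inferInstance
        exact isArtinian_of_surjective_algebraMap (R := R ⧸ m) Ideal.Quotient.mk_surjective
      have h₃ : IsArtinian R (m • ⊤ : Submodule R N) := by
        have h : (m • ⊤ : Submodule R N).map N.subtype = m • N := by
          rw [Submodule.map_smul'', Submodule.map_subtype_top]
        have : IsArtinian R ((m • ⊤ : Submodule R N).map N.subtype) := h ▸ h₁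
        exact isArtinian_of_linearEquiv
          (Submodule.equivMapOfInjective N.subtype N.injective_subtype (m • ⊤)).symm
      exact (isArtinian_iff_submodule_quotient (m • ⊤ : Submodule R N)).2 ⟨h₃, h₂⟩
  have := H n ⊤ fun a ha x _ => h a ha x
  exact isArtinian_of_linearEquiv (Submodule.topEquiv (R := R) (M := A))

/-- If `A ⧸ N` and `A ⧸ J A` are Artinian, then so is `N ⧸ J N`. -/
theorem isArtinian_quotient_smul_top_of_submodule {J : Ideal R} (hJ : J.FG) (N : Submodule R A)
    [IsArtinian R (A ⧸ N)] [IsArtinian R (A ⧸ (J • ⊤ : Submodule R A))] :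
    IsArtinian R (N ⧸ (J • ⊤ : Submodule R N)) := by
  obtain ⟨n, s, rfl⟩ := Submodule.fg_iff_exists_fin_generating_family.1 hJ
  set J := Submodule.span R (Set.range s)
  have hs (i : Fin n) : s i ∈ J := Submodule.subset_span ⟨i, rfl⟩
  let φ : (Fin n → A) →ₗ[R] A := ∑ i, (LinearMap.lsmul R A (s i)).comp (LinearMap.proj i)
  have hφ (k : Fin n → A) : φ k = ∑ i, s i • k i := by simp [φ]
  have hφr : (J • ⊤ : Submodule R A) = LinearMap.range φ := by
    apply le_antisymm
    · rw [Submodule.smul_le]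
      intro a ha y _
      induction ha using Submodule.span_induction with
      | mem a ha =>
        obtain ⟨i, rfl⟩ := ha
        refine ⟨Pi.single i y, ?_⟩
        rw [hφ, Finset.sum_eq_single i]
        · simp
        · intro j _ hj
          simp [hj]
        · simp
      | zero => rw [zero_smul]; exact Submodule.zero_mem _
      | add a b _ _ ha hb => rw [add_smul]; exact Submodule.add_mem _ ha hb
      | smul r a _ ha => rw [smul_assoc]; exact Submodule.smul_mem _ _ ha
    · rintro _ ⟨k, rfl⟩
      rw [hφ]
      exact Submodule.sum_mem _ fun i _ => Submodule.smul_mem_smul (hs i) trivial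
  -- The kernel of `N / JN → A / JA` is `(N ∩ JA) / JN`, the image of `P` under `ψ`. If all
  -- coordinates of `k` lie in `N`, then `φ k ∈ JN`; so this image is a quotient of a submodule of
  -- `(A / N)^n`.
  let P := N.comap φ
  let ψ : P →ₗ[R] N ⧸ (J • ⊤ : Submodule R N) :=
    (Submodule.mkQ _).comp ((φ.comp P.subtype).codRestrict N fun k => k.2)
  let ρ : P →ₗ[R] (Fin n → A ⧸ N) := (N.mkQ.compLeft (Fin n)).comp P.subtype
  have hρ : LinearMap.ker ρ ≤ LinearMap.ker ψ := by
    intro k hk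
    have hkN (i : Fin n) : k.1 i ∈ N := (Submodule.Quotient.mk_eq_zero N).1 (congrFun hk i)
    refine (Submodule.Quotient.mk_eq_zero _).2 ?_
    have : (φ.comp P.subtype).codRestrict N (fun k => k.2) k = ∑ i, s i • (⟨k.1 i, hkN i⟩ : N) := by
      apply Subtype.ext
      exact (hφ k.1).trans (by simp)
    rw [this]
    exact Submodule.sum_mem _ fun i _ => Submodule.smul_mem_smul (hs i) trivial
  have : IsArtinian R (P ⧸ LinearMap.ker ρ) :=
    isArtinian_of_injective _ ρ.quotKerEquivRange.injective
  let g : N ⧸ (J • ⊤ : Submodule R N) →ₗ[R] A ⧸ (J • ⊤ : Submodule R A) :=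
    Submodule.mapQ _ _ N.subtype (by
      rw [← Submodule.map_le_iff_le_comap, Submodule.map_smul'']
      exact Submodule.smul_mono le_rfl le_top)
  refine isArtinian_of_range_eq_ker ((LinearMap.ker ρ).liftQ ψ hρ) g ?_
  rw [Submodule.range_liftQ]
  ext y
  obtain ⟨y, rfl⟩ := Submodule.mkQ_surjective _ y
  constructor
  · rintro ⟨k, hk⟩
    rw [← hk]
    refine (Submodule.Quotient.mk_eq_zero _).2 ?_
    rw [hφr]
    exact ⟨k.1, rfl⟩
  · intro hy
    have : (y : A) ∈ (J • ⊤ : Submodule R A) := (Submodule.Quotient.mk_eq_zero _).1 hy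
    rw [hφr] at this
    obtain ⟨k, hk⟩ := this
    exact ⟨⟨k, show φ k ∈ N from hk ▸ y.2⟩, congrArg (Submodule.mkQ _) (Subtype.ext hk)⟩

/-- The preceding lemma handles the image of `f`. The kernel of `A / JA → f(A) / J f(A)` is the
image of `ker f`, so only the part of `ker f` that survives modulo `J` has to be Artinian. -/
theorem isArtinian_quotient_smul_top {J : Ideal R} (hJ : J.FG) (f : A →ₗ[R] B)
    [IsArtinian R (B ⧸ LinearMap.range f)] [IsArtinian R (B ⧸ (J • ⊤ : Submodule R B))]
    [IsArtinian R ((LinearMap.ker f).map (J • ⊤ : Submodule R A).mkQ)] :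
    IsArtinian R (A ⧸ (J • ⊤ : Submodule R A)) := by
  have := isArtinian_quotient_smul_top_of_submodule hJ (LinearMap.range f)
  have hmap : (J • ⊤ : Submodule R A).map f.rangeRestrict = J • ⊤ := by
    rw [Submodule.map_smul'', Submodule.map_top, LinearMap.range_rangeRestrict]
  let g : A ⧸ (J • ⊤ : Submodule R A) →ₗ[R]
      LinearMap.range f ⧸ (J • ⊤ : Submodule R (LinearMap.range f)) :=
    Submodule.mapQ _ _ f.rangeRestrict (Submodule.map_le_iff_le_comap.1 hmap.le)
  refine isArtinian_of_range_eq_ker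
    ((LinearMap.ker f).map (J • ⊤ : Submodule R A).mkQ).subtype g ?_
  rw [Submodule.range_subtype]
  ext y
  obtain ⟨y, rfl⟩ := Submodule.mkQ_surjective _ y
  constructor
  · rintro ⟨k, hk, hky⟩
    rw [← hky]
    have : f.rangeRestrict k = 0 := Subtype.ext hk
    refine (Submodule.Quotient.mk_eq_zero _).2 ?_
    rw [this]
    exact Submodule.zero_mem _
  · intro hy
    have : f.rangeRestrict y ∈ (J • ⊤ : Submodule R (LinearMap.range f)) :=
      (Submodule.Quotient.mk_eq_zero _).1 hy
    rw [← hmap] at this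
    obtain ⟨z, hz, hzy⟩ := this
    refine ⟨y - z, ?_, ?_⟩
    · have : f z = f y := congrArg Subtype.val hzy
      change f (y - z) = 0
      rw [map_sub, this, sub_self]
    · rw [map_sub]
      exact sub_eq_self.2 ((Submodule.Quotient.mk_eq_zero _).2 hz)

end Artinian

/-! ### Regular elements modulo torsion. -/

section Regular

variable {R : Type u} [CommRing R] [IsNoetherianRing R] (I : Ideal R)
  (A : Type u) [AddCommGroup A] [Module R A] [Module.Finite R A]

theorem exists_pow_smul_torsion_bot :
    ∃ n : ℕ, ∀ a ∈ I ^ n, ∀ x : torsion I ⊥ A, a • x = 0 := by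
  obtain ⟨n, hn⟩ := exists_pow_smul_eq_zero I (N := torsion I ⊥ A) (IsNoetherian.noetherian _) le_rfl
  exact ⟨n, fun a ha x => Subtype.ext (hn a ha x x.2)⟩

/-- `A ⧸ Γ_I(A)` has no `I`-torsion, so some element of `I` is regular on it. -/
theorem exists_isSMulRegular_quotient_torsion :
    ∃ x ∈ I, IsSMulRegular (A ⧸ torsion I ⊥ A) x := by
  by_contra! h
  -- Otherwise prime avoidance puts `I` inside the annihilator of some class `y`. Then `I y ⊆
  -- Γ_I(A)`, so a power of `I` kills `y` and the class is zero.
  have hsub : (I : Set R) ⊆ ⋃ p ∈ associatedPrimes R (A ⧸ torsion I ⊥ A), (p : Set R) := by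
    rw [biUnion_associatedPrimes_eq_compl_regular]
    exact h
  obtain ⟨p, hp, hIp⟩ := (I.subset_union_prime_finite (associatedPrimes.finite R (A ⧸ torsion I ⊥ A))
    (f := id) 0 0 fun _ h _ _ => h.1).1 hsub
  rw [AssociatedPrimes.mem_iff, isAssociatedPrime_iff] at hp
  obtain ⟨hprime, y, rfl⟩ := hp
  obtain ⟨y, rfl⟩ := (torsion I ⊥ A).mkQ_surjective y
  have hI : ∀ b ∈ I, b • y ∈ torsion I ⊥ A := fun b hb => by
    have h₁ : b • (torsion I ⊥ A).mkQ y = 0 := by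
      simpa [Submodule.mem_colon_singleton] using hIp hb
    rw [← map_smul] at h₁
    exact (Submodule.Quotient.mk_eq_zero _).1 h₁
  obtain ⟨n, hn⟩ := exists_pow_smul_torsion_bot I A
  have hy : y ∈ torsion I ⊥ A := (mem_torsion_bot I).2 ⟨n + 1, fun a ha => by
    rw [pow_succ] at ha
    induction ha using Submodule.mul_induction_on' with
    | mem_mul_mem a ha b hb =>
      rw [mul_smul]
      exact congrArg Subtype.val (hn a ha ⟨b • y, hI b hb⟩)
    | add a _ b _ ha hb => rw [add_smul, ha, hb, add_zero]⟩
  refine hprime.ne_top ((Ideal.eq_top_iff_one _).2 ?_)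
  have h₁ : (torsion I ⊥ A).mkQ y = 0 := (Submodule.Quotient.mk_eq_zero _).2 hy
  rw [h₁]
  simp [Submodule.mem_colon_singleton]

end Regular

/-! ### The theorem for a pair of ideals with maximal sum. -/

section Main

variable {R : Type u} [CommRing R] (I J : Ideal R)
variable {A : Type u} [AddCommGroup A] [Module R A]

/-- Iterating `I ^ n x ⊆ J x` gives `I ^ (n * m) x ⊆ J ^ m x`, which is zero for `m = k`. -/
theorem mem_torsion_bot_of_mem_torsion {k : ℕ} (hA : ∀ a ∈ J ^ k, ∀ x : A, a • x = 0) {x : A}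
    (hx : x ∈ torsion I J A) : x ∈ torsion I ⊥ A := by
  obtain ⟨n, hn⟩ := isPairTorsion_iff.1 hx
  have key (m : ℕ) : ∀ a ∈ (I ^ n) ^ m, ∃ j ∈ J ^ m, j • x = a • x := by
    induction m with
    | zero => exact fun a _ => ⟨a, by simp, rfl⟩
    | succ m ih =>
      intro a ha
      rw [pow_succ] at ha
      induction ha using Submodule.mul_induction_on' with
      | mem_mul_mem a ha b hb =>
        obtain ⟨j, hj, hja⟩ := ih a ha
        obtain ⟨i, hi, hib⟩ := hn b hb
        exact ⟨j * i, Ideal.mul_mem_mul hj hi, by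
          rw [mul_smul, hib, smul_comm, hja, smul_comm, mul_smul]⟩
      | add a _ b _ ha hb =>
        obtain ⟨j, hj, hja⟩ := ha
        obtain ⟨i, hi, hib⟩ := hb
        exact ⟨j + i, Ideal.add_mem _ hj hi, by rw [add_smul, add_smul, hja, hib]⟩
  refine (mem_torsion_bot I).2 ⟨n * k, fun a ha => ?_⟩
  rw [pow_mul] at ha
  obtain ⟨j, hj, h⟩ := key k a ha
  rw [← h, hA j hj]

theorem isArtinian_quotient_range_of_exact {A B C : Type*} [AddCommGroup A] [Module R A]
    [AddCommGroup B] [Module R B] [AddCommGroup C] [Module R C] [IsArtinian R C] {f : A →ₗ[R] B}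
    {g : B →ₗ[R] C} (h : Function.Exact f g) : IsArtinian R (B ⧸ LinearMap.range f) := by
  rw [← LinearMap.exact_iff.1 h]
  exact isArtinian_of_injective _ g.quotKerEquivRange.injective

theorem isArtinian_ker_of_exact {A B C : Type*} [AddCommGroup A] [Module R A]
    [AddCommGroup B] [Module R B] [AddCommGroup C] [Module R C] [IsArtinian R A] {f : A →ₗ[R] B}
    {g : B →ₗ[R] C} (h : Function.Exact f g) : IsArtinian R (LinearMap.ker g) := by
  rw [LinearMap.exact_iff.1 h]
  exact isArtinian_of_surjective _ f.rangeRestrict f.surjective_rangeRestrict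

/-- The long exact sequence of multiplication by a regular element. -/
theorem exists_derivedTorsion_exact_lsmul (n : ℕ) {r : R} (hr : IsSMulRegular A r) :
    ∃ δ : derivedTorsion I J n (A ⧸ LinearMap.range (LinearMap.lsmul R A r)) →ₗ[R]
        derivedTorsion I J (n + 1) A,
      Function.Exact (LinearMap.lsmul R (derivedTorsion I J n A) r)
        (derivedTorsionMap I J n (LinearMap.range (LinearMap.lsmul R A r)).mkQ) ∧
      Function.Exact (derivedTorsionMap I J n (LinearMap.range (LinearMap.lsmul R A r)).mkQ) δ ∧
      Function.Exact δ (LinearMap.lsmul R (derivedTorsion I J (n + 1) A) r) := by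
  have h (m : ℕ) : derivedTorsionMap I J m (LinearMap.lsmul R A r) =
      LinearMap.lsmul R (derivedTorsion I J m A) r :=
    LinearMap.ext (derivedTorsionMap_lsmul I J m r)
  have := exists_derivedTorsion_exact I J n (f := LinearMap.lsmul R A r) hr
    (LinearMap.range (LinearMap.lsmul R A r)).mkQ_surjective (LinearMap.exact_map_mkQ_range _)
  rwa [h, h] at this

theorem derivedTorsion_subsingleton_of_subsingleton [Subsingleton A] (n : ℕ) :
    Subsingleton (derivedTorsion I J n A) :=
  subsingleton_of_forall_eq 0 fun x => by
    rw [← one_smul R x]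
    exact derivedTorsion_smul_eq_zero I J (fun _ => Subsingleton.elim _ _) n x

variable [IsNoetherianRing R] [hIJ : (I ⊔ J).IsMaximal]

/-- Here every `H^i` is `I`-torsion. In degree zero it is finitely generated and killed by a power
of the maximal ideal `I ⊔ J`. In higher degrees `Γ_I(A)` contributes nothing, and for `r ∈ I`
regular on `A / Γ_I(A)` the kernel of `r` on cohomology is an image of the previous degree;
`isArtinian_of_ker_lsmul` concludes. -/
theorem isArtinian_derivedTorsion_of_pow_smul (n : ℕ) (A : Type u) [AddCommGroup A] [Module R A]
    [Module.Finite R A] {k : ℕ} (hA : ∀ a ∈ J ^ k, ∀ x : A, a • x = 0) :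
    IsArtinian R (derivedTorsion I J n A) := by
  induction n generalizing A with
  | zero =>
    have hle : torsion I J A ≤ torsion I ⊥ A := fun x hx => mem_torsion_bot_of_mem_torsion I J hA hx
    obtain ⟨n, hn⟩ := exists_pow_smul_eq_zero I (IsNoetherian.noetherian (torsion I J A)) hle
    have : IsArtinian R (torsion I J A) := by
      refine isArtinian_of_pow_smul_eq_zero (m := I ⊔ J) (n := n + k) fun a ha x => ?_
      obtain ⟨b, hb, c, hc, rfl⟩ := Submodule.mem_sup.1 (Ideal.sup_pow_add_le_pow_sup_pow ha)
      rw [add_smul]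
      exact Subtype.ext (by simp [hn b hb x x.2, hA c hc])
    exact isArtinian_of_linearEquiv (derivedTorsionZeroEquiv I J (A := A)).symm
  | succ n ih =>
    obtain ⟨r, hrI, hr⟩ := exists_isSMulRegular_quotient_torsion I A
    have hQ {N : Submodule R A} : ∀ a ∈ J ^ k, ∀ x : A ⧸ N, a • x = 0 := fun a ha x => by
      obtain ⟨x, rfl⟩ := N.mkQ_surjective x
      rw [← map_smul, hA a ha, map_zero]
    obtain ⟨δ, -, -, hδ⟩ := exists_derivedTorsion_exact_lsmul I J n hr
    have := ih ((A ⧸ torsion I ⊥ A) ⧸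
        LinearMap.range (LinearMap.lsmul R (A ⧸ torsion I ⊥ A) r)) fun a ha x => by
      obtain ⟨x, rfl⟩ := Submodule.mkQ_surjective _ x
      rw [← map_smul, hQ a ha, map_zero]
    have := isArtinian_ker_of_exact hδ
    have : IsArtinian R (derivedTorsion I J (n + 1) (A ⧸ torsion I ⊥ A)) := by
      refine isArtinian_of_ker_lsmul r fun x => ?_
      obtain ⟨m, hm⟩ := (mem_torsion_bot I).1 (mem_torsion_bot_of_mem_torsion I J
        (fun a ha y => derivedTorsion_smul_eq_zero I J (hQ a ha) (n + 1) y)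
        (derivedTorsion_mem_torsion I J (n + 1) x))
      exact ⟨m, hm _ (Ideal.pow_mem_pow hrI m)⟩
    have := derivedTorsion_subsingleton I J n (torsion I ⊥ A) (mem_torsion_torsion I ⊥)
    obtain ⟨_, h, -, -⟩ := exists_derivedTorsion_exact I J (n + 1)
      (torsion I ⊥ A).injective_subtype (torsion I ⊥ A).mkQ_surjective
      (LinearMap.exact_subtype_mkQ _)
    exact isArtinian_of_exact h

theorem isArtinian_derivedTorsion_torsion_bot (n : ℕ) (A : Type u) [AddCommGroup A] [Module R A]
    [Module.Finite R A] : IsArtinian R (derivedTorsion I J n (torsion J ⊥ A)) := by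
  obtain ⟨k, hk⟩ := exists_pow_smul_torsion_bot J A
  exact isArtinian_derivedTorsion_of_pow_smul I J n _ hk

/-- If `H^i_{I,J}(A)` is Artinian for `i > c`, then `H^c_{I,J}(A) ⧸ J H^c_{I,J}(A)` is Artinian. -/
theorem isArtinian_derivedTorsion_quotient (c : ℕ) (M : Type u) [AddCommGroup M] [Module R M]
    [Module.Finite R M] (N : Submodule R M) (A : Type u) [AddCommGroup A] [Module R A]
    (f : M →ₗ[R] A) (hf : Function.Surjective f) (hN : LinearMap.ker f = N)
    (h : ∀ i, c < i → IsArtinian R (derivedTorsion I J i A)) :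
    IsArtinian R (derivedTorsion I J c A ⧸ (J • ⊤ : Submodule R (derivedTorsion I J c A))) := by
  induction N using WellFoundedGT.induction generalizing A with
  | ind N ih =>
  have : Module.Finite R A := Module.Finite.of_surjective f hf
  have hT (i : ℕ) := isArtinian_derivedTorsion_torsion_bot I J i A
  obtain ⟨r, hrJ, hr⟩ := exists_isSMulRegular_quotient_torsion J A
  have hex := (LinearMap.exact_subtype_mkQ (torsion J ⊥ A))
  obtain ⟨δ, hc₁, hc₂, -⟩ := exists_derivedTorsion_exact I J c
    (torsion J ⊥ A).injective_subtype (torsion J ⊥ A).mkQ_surjective hex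
  -- When the quotient is zero, dividing by `r` gives no smaller quotient of `M`, but `H^c(A)` is
  -- then an image of `H^c(Γ_J(A))`.
  by_cases hs : Subsingleton (A ⧸ torsion J ⊥ A)
  · have := derivedTorsion_subsingleton_of_subsingleton I J (A := A ⧸ torsion J ⊥ A) c
    have := isArtinian_of_exact hc₁
    infer_instance
  have hQ (i : ℕ) (hi : c < i) : IsArtinian R (derivedTorsion I J i (A ⧸ torsion J ⊥ A)) := by
    obtain ⟨_, -, h₂, -⟩ := exists_derivedTorsion_exact I J i
      (torsion J ⊥ A).injective_subtype (torsion J ⊥ A).mkQ_surjective hex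
    have := h i hi
    exact isArtinian_of_exact h₂
  set B := A ⧸ torsion J ⊥ A
  have hB (i : ℕ) (hi : c < i) : IsArtinian R
      (derivedTorsion I J i (B ⧸ LinearMap.range (LinearMap.lsmul R B r))) := by
    obtain ⟨_, -, h₂, -⟩ := exists_derivedTorsion_exact_lsmul I J i hr
    have := hQ i hi
    have := hQ (i + 1) (hi.trans i.lt_succ_self)
    exact isArtinian_of_exact h₂
  obtain ⟨ε, hε₁, hε₂, -⟩ := exists_derivedTorsion_exact_lsmul I J c hr
  let g : M →ₗ[R] B ⧸ LinearMap.range (LinearMap.lsmul R B r) :=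
    (Submodule.mkQ _).comp ((torsion J ⊥ A).mkQ.comp f)
  have hg : Function.Surjective g :=
    (Submodule.mkQ_surjective _).comp ((Submodule.mkQ_surjective _).comp hf)
  -- For `b ≠ 0` in `B`, regularity gives `r • b ≠ 0`; a preimage of it in `M` lies in the new
  -- kernel but not in `N`.
  have hlt : N < LinearMap.ker g := by
    rw [not_subsingleton_iff_nontrivial] at hs
    obtain ⟨b, hb⟩ := exists_ne (0 : B)
    obtain ⟨m, hm⟩ := ((Submodule.mkQ_surjective _).comp hf) (r • b)
    rw [← hN]
    refine lt_of_le_of_ne (fun x hx => ?_) fun heq => hb ?_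
    · have : f x = 0 := hx
      simp [g, this]
    · have hmg : m ∈ LinearMap.ker g := (Submodule.Quotient.mk_eq_zero _).2 ⟨b, hm.symm⟩
      rw [← heq] at hmg
      have : f m = 0 := hmg
      refine hr ?_
      change r • b = r • 0
      rw [← hm, Function.comp_apply, this, map_zero, smul_zero]
  have := ih _ hlt _ g hg rfl hB
  have := hQ (c + 1) c.lt_succ_self
  have := isArtinian_quotient_range_of_exact hε₂
  have hJ : J.FG := IsNoetherian.noetherian J
  have : IsArtinian R (derivedTorsion I J c B ⧸ (J • ⊤ : Submodule R (derivedTorsion I J c B))) := by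
    -- By exactness the kernel is `r H^c(B)`, and `r ∈ J`.
    have hbot : (LinearMap.ker (derivedTorsionMap I J c
        (LinearMap.range (LinearMap.lsmul R B r)).mkQ)).map
        (J • ⊤ : Submodule R (derivedTorsion I J c B)).mkQ = ⊥ := by
      rw [LinearMap.exact_iff.1 hε₁, eq_bot_iff]
      rintro _ ⟨_, ⟨y, rfl⟩, rfl⟩
      exact (Submodule.Quotient.mk_eq_zero _).2 (Submodule.smul_mem_smul hrJ trivial)
    have : IsArtinian R ((LinearMap.ker (derivedTorsionMap I J c
        (LinearMap.range (LinearMap.lsmul R B r)).mkQ)).map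
        (J • ⊤ : Submodule R (derivedTorsion I J c B)).mkQ) := by
      rw [hbot]
      infer_instance
    exact isArtinian_quotient_smul_top hJ (derivedTorsionMap I J c
      (LinearMap.range (LinearMap.lsmul R B r)).mkQ)
  -- From `B` back to `A`: the cokernel of `H^c(A) → H^c(B)` embeds in `H^{c+1}(Γ_J(A))` and the
  -- kernel is an image of `H^c(Γ_J(A))`.
  have := isArtinian_quotient_range_of_exact hc₂
  have := isArtinian_ker_of_exact hc₁
  have := isArtinian_of_surjective _ _ (LinearMap.submoduleMap_surjective
    (J • ⊤ : Submodule R (derivedTorsion I J c A)).mkQ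
    (LinearMap.ker (derivedTorsionMap I J c (torsion J ⊥ A).mkQ)))
  exact isArtinian_quotient_smul_top hJ (derivedTorsionMap I J c (torsion J ⊥ A).mkQ)

end Main

/-! ### What the grading provides. -/

section Graded

variable {R : Type u} [CommRing R] (𝒜 : ℕ → AddSubgroup R) [GradedRing 𝒜]

theorem IsStandardGraded.isNoetherianRing (h : IsStandardGraded 𝒜) : IsNoetherianRing R := by
  have := h.isNoetherianRing_zero
  obtain ⟨s, -, hs⟩ := h.exists_generators
  have : Algebra.FiniteType (𝒜 0) R := ⟨⟨s, hs⟩⟩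
  exact Algebra.FiniteType.isNoetherianRing (𝒜 0) R

/-- `R_+ + m₀R` is the kernel of the projection of `R` to the residue field of `R_0`. -/
theorem isMaximal_irrelevantIdeal_sup [IsLocalRing (𝒜 0)] :
    (irrelevantIdeal 𝒜 ⊔ baseMaximalIdeal 𝒜).IsMaximal := by
  let π : R →+* 𝒜 0 := GradedRing.projZeroRingHom' 𝒜
  let φ : R →+* IsLocalRing.ResidueField (𝒜 0) := (IsLocalRing.residue (𝒜 0)).comp π
  have hπ (a : 𝒜 0) : π a = a := GradedRing.projZeroRingHom'_apply_coe 𝒜 a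
  have hφ : Function.Surjective φ :=
    IsLocalRing.residue_surjective.comp fun a => ⟨a, hπ a⟩
  have hker : irrelevantIdeal 𝒜 ⊔ baseMaximalIdeal 𝒜 = RingHom.ker φ := by
    apply le_antisymm
    · refine sup_le (fun x hx => ?_) (Ideal.map_le_iff_le_comap.2 fun a ha => ?_)
      · have : π x = 0 := Subtype.ext hx
        rw [RingHom.mem_ker, RingHom.comp_apply, this, map_zero]
      · have : φ (a : R) = 0 := by
          rw [RingHom.comp_apply, hπ]
          exact (IsLocalRing.residue_eq_zero_iff a).2 ha
        exact this
    · intro x hx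
      have hm : π x ∈ IsLocalRing.maximalIdeal (𝒜 0) := (IsLocalRing.residue_eq_zero_iff _).1 hx
      have h₁ : x - (π x : R) ∈ irrelevantIdeal 𝒜 := by
        have : π (x - (π x : R)) = 0 := by rw [map_sub, hπ, sub_self]
        exact congrArg Subtype.val this
      rw [← sub_add_cancel x (π x : R)]
      exact Submodule.add_mem_sup h₁ (Ideal.mem_map_of_mem (algebraMap (𝒜 0) R) hm)
  rw [hker]
  exact RingHom.ker_isMaximal_of_surjective φ hφ

end Graded

end PairLocalCohomology

end

theorem theorem4p2 {R : Type u} [CommRing R] (𝒜 : ℕ → AddSubgroup R) [GradedRing 𝒜]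
    (h𝒜 : PairLocalCohomology.IsStandardGraded 𝒜) [IsLocalRing (𝒜 0)]
    {M : Type u} [AddCommGroup M] [Module R M] [Module.Finite R M]
    (ℳ : ℤ → AddSubgroup M) (hℳ : PairLocalCohomology.IsGradedModule 𝒜 ℳ)
    (c : ℤ)
    (hArt : ∀ i : ℤ, c < i →
      IsArtinian R (PairLocalCohomology.gradedLocalCohomology 𝒜 M i)) :
    IsArtinian R
      (PairLocalCohomology.gradedLocalCohomology 𝒜 M c ⧸
        (PairLocalCohomology.baseMaximalIdeal 𝒜 • ⊤ :
          Submodule R (PairLocalCohomology.gradedLocalCohomology 𝒜 M c))) := by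
  have := h𝒜.isNoetherianRing
  have := PairLocalCohomology.isMaximal_irrelevantIdeal_sup 𝒜
  -- For `c ≥ 0` the induction starts at the identity of `M`; for `c < 0` the module is zero by
  -- convention.
  rcases c with c | c
  · exact PairLocalCohomology.isArtinian_derivedTorsion_quotient _ _ c M _ M LinearMap.id
      Function.surjective_id rfl fun i hi => hArt (Int.ofNat i) (Int.ofNat_lt.2 hi)
  · have : Subsingleton (PairLocalCohomology.gradedLocalCohomology 𝒜 M (Int.negSucc c)) :=
      inferInstanceAs (Subsingleton PUnit)
    infer_instance
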